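/- Let $0<\gamma<1$ and let the scalar field $\mathbb K$ be $\mathbb R$ or $\mathbb C$. Let $\Lambda_\gamma$ be the space of $2\pi$-periodic functions $\phi:\mathbb R\to\mathbb K$ that are Hölder continuous with exponent $\gamma$, with the seminorm $\|\phi\|_{\Lambda_\gamma}=\sup_{x\ne y}|\phi(x)-\phi(y)|/|x-y|^\gamma$, and let $\Lambda_\gamma^e$ be its subspace of even functions. Let $$\mathcal H\phi(\alpha)=\frac1{2\pi}\,\mathrm{p.v.}\!\int_{-\pi}^{\pi}\frac{\phi(\alpha-t)}{\tan(t/2)}\,dt$$ be the periodic Hilbert transform. It is a bounded operator on $\Lambda_\gamma$; write $\|\mathcal H\|_{\Lambda_\gamma\to\Lambda_\gamma}$ for its operator norm with respect to the seminorm, and put $$c_\gamma=\gamma^{-1}\pi^{\gamma-1}+\|\mathcal H\|_{\Lambda_\gamma\to\Lambda_\gamma}(2\pi)^\gamma .$$ Let $L^1(\mathbb R_+)\hat\otimes_\pi\Lambda_\gamma^e$ be the projective tensor product, that is, the (Hausdorff) completion of the algebraic tensor product for the projective seminorm $\inf\{\sum_i\|f_i\|_{L^1}\|\psi_i\|_{\Lambda_\gamma}:u=\sum_i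 f_i\otimes\psi_i\}$, and for a function $\varphi(\rho,\theta)$ let $$\mathcal K_2\varphi(\alpha)=\frac1\pi\int_0^\infty d\rho\;\mathrm{p.v.}\!\int_{-\pi}^{\pi}\frac{\varphi(\rho,\theta)}{\sin(\theta-\alpha)}\,d\theta ,$$ where the principal value is taken symmetrically at the zeros of $\sin(\theta-\alpha)$. Then for every $\alpha\in[-\pi,\pi]$ the map $\varphi\mapsto\mathcal K_2\varphi(\alpha)$ is a bounded linear functional on $L^1(\mathbb R_+)\hat\otimes_\pi\Lambda_\gamma^e$, and its norm is at most $c_\gamma$. More precisely, there is a bounded linear functional $L_\alpha$ on this space with $\|L_\alpha\|\le c_\gamma$ such that, whenever $\sum_n\|f_n\|_{L^1}\|\psi_n\|_{\Lambda_\gamma}<\infty$, $u=\sum_n f_n\otimes\psi_n$ in $L^1(\mathbb R_+)\hat\otimes_\pi\Lambda_\gamma^e$, and $\varphi(\rho,\theta)=\sum_n f_n(\rho)\psi_n(\theta)$ converges for almost every $\rho$ and all $\theta$ (in particular for every finite sum $\varphi=\sum_i f_i\otimes\psi_i$), the integrals defining $\mathcal K_2\varphi(\alpha)$ exist and $L_\alpha(u)=\mathcal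 K_2\varphi(\alpha)$. -/

import Mathlib

open MeasureTheory Set Filter Topology
open scoped NNReal TensorProduct

noncomputable section

/-! ### Periodic Hölder functions -/

/-- The `2π`-periodic functions on `ℝ` that are Hölder continuous with exponent `γ`. -/
def holderSubmodule (𝕜 : Type*) [RCLike 𝕜] (γ : ℝ≥0) : Submodule 𝕜 (ℝ → 𝕜) where
  carrier := {φ | Function.Periodic φ (2 * Real.pi) ∧ MemHolder γ φ}
  add_mem' := fun hf hg => ⟨hf.1.add hg.1, hf.2.add hg.2⟩
  zero_mem' := ⟨fun _ => rfl, memHolder_zero⟩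
  smul_mem' := fun c _ hf => ⟨hf.1.smul c, hf.2.smul⟩

/-- The space `Λ_γ` of `2π`-periodic Hölder functions with exponent `γ`, with the seminorm
`sup |φ x - φ y| / |x - y| ^ γ` below (not the topology of pointwise convergence). -/
def HolderSpace (𝕜 : Type*) [RCLike 𝕜] (γ : ℝ≥0) : Type _ := ↥(holderSubmodule 𝕜 γ)

namespace HolderSpace

variable {𝕜 : Type*} [RCLike 𝕜] {γ : ℝ≥0}

instance : AddCommGroup (HolderSpace 𝕜 γ) := inferInstanceAs (AddCommGroup ↥(holderSubmodule 𝕜 γ))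

instance : Module 𝕜 (HolderSpace 𝕜 γ) := inferInstanceAs (Module 𝕜 ↥(holderSubmodule 𝕜 γ))

instance : CoeFun (HolderSpace 𝕜 γ) (fun _ => ℝ → 𝕜) := ⟨fun φ => φ.1⟩

/-- The Hölder seminorm: the least `C` with `|φ x - φ y| ≤ C |x - y| ^ γ` for all `x`, `y`. -/
def seminorm (𝕜 : Type*) [RCLike 𝕜] (γ : ℝ≥0) : Seminorm 𝕜 (HolderSpace 𝕜 γ) :=
  Seminorm.of (fun φ => (nnHolderNorm γ (φ : ℝ → 𝕜) : ℝ))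
    (fun φ ψ => by exact_mod_cast φ.2.2.nnHolderNorm_add_le ψ.2.2)
    (fun c φ => by
      have h := φ.2.2.nnHolderNorm_smul c
      have h' := congrArg NNReal.toReal h
      rw [NNReal.coe_mul, coe_nnnorm] at h'
      exact h')

instance : SeminormedAddCommGroup (HolderSpace 𝕜 γ) :=
  (HolderSpace.seminorm 𝕜 γ).toAddGroupSeminorm.toSeminormedAddCommGroup

instance : NormedSpace 𝕜 (HolderSpace 𝕜 γ) where
  norm_smul_le c φ := le_of_eq (map_smul_eq_mul (HolderSpace.seminorm 𝕜 γ) c φ)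

end HolderSpace

/-- The subspace `Λ_γ^e` of even functions in `Λ_γ`, with the same seminorm. -/
def evenHolder (𝕜 : Type*) [RCLike 𝕜] (γ : ℝ≥0) : Submodule 𝕜 (HolderSpace 𝕜 γ) where
  carrier := {φ | ∀ x : ℝ, φ (-x) = φ x}
  add_mem' := fun hf hg x => congrArg₂ (· + ·) (hf x) (hg x)
  zero_mem' := fun _ => rfl
  smul_mem' := fun c _ hf x => congrArg (c * ·) (hf x)

/-! ### The projective tensor product -/

/-- The algebraic tensor product `E ⊗ F`, to be equipped with the projective seminorm. -/
def AlgTensor (𝕜 E F : Type*) [RCLike 𝕜] [SeminormedAddCommGroup E] [NormedSpace 𝕜 E]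
    [SeminormedAddCommGroup F] [NormedSpace 𝕜 F] : Type _ := E ⊗[𝕜] F

namespace AlgTensor

variable {𝕜 E F : Type*} [RCLike 𝕜] [SeminormedAddCommGroup E] [NormedSpace 𝕜 E]
  [SeminormedAddCommGroup F] [NormedSpace 𝕜 F]

instance : AddCommGroup (AlgTensor 𝕜 E F) := inferInstanceAs (AddCommGroup (E ⊗[𝕜] F))

instance : Module 𝕜 (AlgTensor 𝕜 E F) := inferInstanceAs (Module 𝕜 (E ⊗[𝕜] F))

variable (𝕜) in
/-- The elementary tensor `x ⊗ y`. -/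
def tmul (x : E) (y : F) : AlgTensor 𝕜 E F := (x ⊗ₜ[𝕜] y : E ⊗[𝕜] F)

/-- The numbers `∑ ‖x i‖ ‖y i‖` over all finite representations `t = ∑ x i ⊗ y i`. -/
def reprCosts (t : AlgTensor 𝕜 E F) : Set ℝ :=
  {r | ∃ (n : ℕ) (x : Fin n → E) (y : Fin n → F),
    t = ∑ i, tmul 𝕜 (x i) (y i) ∧ r = ∑ i, ‖x i‖ * ‖y i‖}

theorem reprCosts_nonneg {t : AlgTensor 𝕜 E F} {r : ℝ} (hr : r ∈ reprCosts t) : 0 ≤ r := by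
  obtain ⟨n, x, y, -, rfl⟩ := hr
  positivity

theorem reprCosts_bddBelow (t : AlgTensor 𝕜 E F) : BddBelow (reprCosts t) :=
  ⟨0, fun _ hr => reprCosts_nonneg hr⟩

theorem reprCosts_add {s t : AlgTensor 𝕜 E F} {a b : ℝ} (ha : a ∈ reprCosts s)
    (hb : b ∈ reprCosts t) : a + b ∈ reprCosts (s + t) := by
  obtain ⟨n, x, y, rfl, rfl⟩ := ha
  obtain ⟨m, x', y', rfl, rfl⟩ := hb
  exact ⟨n + m, Fin.append x x', Fin.append y y', by simp [Fin.sum_univ_add],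
    by simp [Fin.sum_univ_add]⟩

theorem reprCosts_smul {t : AlgTensor 𝕜 E F} {a : ℝ} (c : 𝕜) (ha : a ∈ reprCosts t) :
    ‖c‖ * a ∈ reprCosts (c • t) := by
  obtain ⟨n, x, y, rfl, rfl⟩ := ha
  refine ⟨n, fun i => c • x i, y, ?_, ?_⟩
  · rw [Finset.smul_sum]
    exact Finset.sum_congr rfl fun i _ => TensorProduct.smul_tmul' c (x i) (y i)
  · rw [Finset.mul_sum]
    exact Finset.sum_congr rfl fun i _ => by rw [norm_smul, mul_assoc]

theorem reprCosts_nonempty (t : AlgTensor 𝕜 E F) : (reprCosts t).Nonempty := by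
  refine TensorProduct.induction_on (motive := fun t => (reprCosts (𝕜 := 𝕜) t).Nonempty) t
    ⟨0, 0, Fin.elim0, Fin.elim0, by simp; rfl, by simp⟩
    (fun x y => ⟨‖x‖ * ‖y‖, 1, fun _ => x, fun _ => y, (Fin.sum_univ_one (fun _ : Fin 1 => tmul 𝕜 x y)).symm, by simp⟩)
    (fun s t hs ht => ?_)
  obtain ⟨a, ha⟩ := hs
  obtain ⟨b, hb⟩ := ht
  exact ⟨a + b, reprCosts_add ha hb⟩

/-- The projective seminorm `π(t) = inf {∑ ‖x i‖ ‖y i‖ : t = ∑ x i ⊗ y i}`. -/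
def projSeminorm (𝕜 E F : Type*) [RCLike 𝕜] [SeminormedAddCommGroup E] [NormedSpace 𝕜 E]
    [SeminormedAddCommGroup F] [NormedSpace 𝕜 F] : Seminorm 𝕜 (AlgTensor 𝕜 E F) :=
  Seminorm.ofSMulLE (fun t => sInf (reprCosts t))
    (le_antisymm
      (csInf_le (reprCosts_bddBelow _) ⟨0, Fin.elim0, Fin.elim0, by simp, by simp⟩)
      (Real.sInf_nonneg fun _ hr => reprCosts_nonneg hr))
    (fun s t => by
      refine le_of_forall_pos_le_add fun ε hε => ?_
      obtain ⟨a, ha, ha'⟩ := Real.lt_sInf_add_pos (reprCosts_nonempty s) (half_pos hε)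
      obtain ⟨b, hb, hb'⟩ := Real.lt_sInf_add_pos (reprCosts_nonempty t) (half_pos hε)
      have := csInf_le (reprCosts_bddBelow _) (reprCosts_add ha hb)
      linarith)
    (fun c t => by
      have h : ∀ a ∈ reprCosts t, sInf (reprCosts (c • t)) ≤ ‖c‖ * a := fun a ha =>
        csInf_le (reprCosts_bddBelow _) (reprCosts_smul c ha)
      rw [← smul_eq_mul, ← Real.sInf_smul_of_nonneg (norm_nonneg c)]
      refine le_csInf ((reprCosts_nonempty t).smul_set) ?_
      rintro _ ⟨a, ha, rfl⟩
      exact h a ha)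

instance : SeminormedAddCommGroup (AlgTensor 𝕜 E F) :=
  (projSeminorm 𝕜 E F).toAddGroupSeminorm.toSeminormedAddCommGroup

instance : NormedSpace 𝕜 (AlgTensor 𝕜 E F) where
  norm_smul_le c t := le_of_eq (map_smul_eq_mul (projSeminorm 𝕜 E F) c t)

end AlgTensor

/-- The projective tensor product `E ⊗̂_π F`: the (Hausdorff) completion of `E ⊗ F` for the
projective seminorm. -/
abbrev ProjTensor (𝕜 E F : Type*) [RCLike 𝕜] [SeminormedAddCommGroup E] [NormedSpace 𝕜 E]
    [SeminormedAddCommGroup F] [NormedSpace 𝕜 F] : Type _ :=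
  UniformSpace.Completion (AlgTensor 𝕜 E F)

/-! ### Principal values, the Hilbert transform and the operator `𝒦₂` -/

/-- `[-π, π]` without the open `ε`-neighbourhoods of the zeros of `t ↦ sin (t - α)`,
that is, of the points `α + kπ`. -/
def truncatedInterval (α ε : ℝ) : Set ℝ :=
  {t | t ∈ Icc (-Real.pi) Real.pi ∧ ∀ s : ℝ, Real.sin (s - α) = 0 → ε ≤ |t - s|}

/-- The integral of `f` over `[-π, π]` exists as a principal value at the points `α + kπ`, and
equals `v`. For `α = 0` this is `lim_{ε → 0+} (∫_{-π+ε}^{-ε} f + ∫_{ε}^{π-ε} f) = v`. -/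
def HasPV {𝕜 : Type*} [RCLike 𝕜] (α : ℝ) (f : ℝ → 𝕜) (v : 𝕜) : Prop :=
  (∀ ε > 0, IntegrableOn f (truncatedInterval α ε)) ∧
    Tendsto (fun ε : ℝ => ∫ t in truncatedInterval α ε, f t) (𝓝[>] 0) (𝓝 v)

/-- `v` is the value at `α` of the Hilbert transform
`ℋφ(α) = (1 / 2π) p.v. ∫_{-π}^{π} φ(α - t) / tan (t / 2) dt`. -/
def IsHilbertValue {𝕜 : Type*} [RCLike 𝕜] (φ : ℝ → 𝕜) (α : ℝ) (v : 𝕜) : Prop :=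
  ∃ w : 𝕜, HasPV 0 (fun t : ℝ => φ (α - t) / ((Real.tan (t / 2) : ℝ) : 𝕜)) w ∧
    v = ((1 / (2 * Real.pi) : ℝ) : 𝕜) * w

/-- `v` is the value at `α` of
`𝒦₂φ(α) = (1 / π) ∫_0^∞ dρ p.v. ∫_{-π}^{π} φ(ρ, θ) / sin (θ - α) dθ`; this includes that the
inner integral exists for almost every `ρ` and that the outer one converges absolutely. -/
def IsK2Value {𝕜 : Type*} [RCLike 𝕜] (φ : ℝ → ℝ → 𝕜) (α : ℝ) (v : 𝕜) : Prop :=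
  ∃ g : ℝ → 𝕜,
    (∀ᵐ ρ ∂(volume.restrict (Ioi (0 : ℝ))),
      HasPV α (fun θ : ℝ => φ ρ θ / ((Real.sin (θ - α) : ℝ) : 𝕜)) (g ρ)) ∧
    IntegrableOn g (Ioi 0) ∧
    v = ((1 / Real.pi : ℝ) : 𝕜) * ∫ ρ in Ioi (0 : ℝ), g ρ

/-- The space `L¹(ℝ₊)`. -/
abbrev L1Pos (𝕜 : Type*) [RCLike 𝕜] : Type _ := Lp 𝕜 1 (volume.restrict (Ioi (0 : ℝ)))

/-- The function `φ(ρ, θ)` represents the element `u` of `L¹(ℝ₊) ⊗̂_π Λ_γ^e`: for some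
`f n`, `ψ n` with `∑ ‖f n‖ ‖ψ n‖ < ∞` one has `u = ∑ f n ⊗ ψ n` in the tensor product, and
`φ(ρ, θ) = ∑ f n (ρ) ψ n (θ)` for almost every `ρ` and all `θ`. Finite sums are included. -/
def Represents {𝕜 : Type*} [RCLike 𝕜] {γ : ℝ≥0} (φ : ℝ → ℝ → 𝕜)
    (u : ProjTensor 𝕜 (L1Pos 𝕜) (evenHolder 𝕜 γ)) : Prop :=
  ∃ (f : ℕ → L1Pos 𝕜) (ψ : ℕ → evenHolder 𝕜 γ),
    Summable (fun n => ‖f n‖ * ‖ψ n‖) ∧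
    HasSum (fun n => ((AlgTensor.tmul 𝕜 (f n) (ψ n) : AlgTensor 𝕜 (L1Pos 𝕜) (evenHolder 𝕜 γ)) :
      ProjTensor 𝕜 (L1Pos 𝕜) (evenHolder 𝕜 γ))) u ∧
    ∀ᵐ ρ ∂(volume.restrict (Ioi (0 : ℝ))), ∀ θ : ℝ,
      HasSum (fun n => f n ρ * (ψ n : HolderSpace 𝕜 γ) θ) (φ ρ θ)

end

/-! ### The kernels `cot (t / 2)` and its regularisation -/

/-! The identity `1 / sin t = (cot (t / 2) - cot ((t + π) / 2)) / 2` splits the kernel of `𝒦₂` into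
two Hilbert kernels. With principal values cut symmetrically at both zeros of the sine it gives p.v.
`∫ ψ(θ) / sin (θ - α) dθ = π (ℋψ(α + π) - ℋψ(α))`. So on `f ⊗ ψ` the operator is the product of two
bounded functionals, `∫ f` and `B ψ = ℋψ(α + π) - ℋψ(α)`. The first has norm at most 1, the second
at most `π ^ γ ‖ℋ‖`, because the two points are `π` apart. A product of bounded functionals extends
to the projective tensor product with the product of the bounds, and `π ^ γ ‖ℋ‖ ≤ c_γ`.

Two analytic points remain. Boundedness of `ℋ` on `Λ_γ` (Privalov) is `norm_hilbertIntegral_sub_le`: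
the kernel is regularised at scale `h = |α - β|`, and each resulting error is `O(h ^ γ)` by scaling
of `∫ |t| ^ q / (t ^ 2 + h ^ 2)`. For infinite sums, `isK2Value_of_represents` shows that for almost
every `ρ` the series `∑ f n (ρ) ψ n` converges in the seminorm of `Λ_γ` as well as pointwise, so `B`
may be applied term by term. -/

theorem integrable_abs_rpow_div_sq_add_one {q : ℝ} (hq : -1 < q) (hq1 : q < 1) :
    Integrable fun t : ℝ => |t| ^ q / (t ^ 2 + 1) := by
  have hm : Measurable fun t : ℝ => |t| ^ q / (t ^ 2 + 1) := by fun_prop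
  have hIoc : IntegrableOn (fun t : ℝ => |t| ^ q / (t ^ 2 + 1)) (Ioc 0 1) := by
    have h := (intervalIntegral.intervalIntegrable_rpow' (a := 0) (b := 1) hq)
    rw [intervalIntegrable_iff_integrableOn_Ioc_of_le zero_le_one] at h
    refine h.mono' hm.aestronglyMeasurable ?_
    filter_upwards [ae_restrict_mem measurableSet_Ioc] with t ht
    rw [Real.norm_of_nonneg (by positivity), abs_of_pos ht.1]
    exact div_le_self (by have := ht.1; positivity) (by nlinarith [sq_nonneg t])
  have hIoi1 : IntegrableOn (fun t : ℝ => |t| ^ q / (t ^ 2 + 1)) (Ioi 1) := by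
    have h := integrableOn_Ioi_rpow_of_lt (a := q - 2) (c := 1) (by linarith) one_pos
    refine h.mono' hm.aestronglyMeasurable ?_
    filter_upwards [ae_restrict_mem measurableSet_Ioi] with t ht
    have ht0 : (0 : ℝ) < t := lt_trans one_pos ht
    rw [Real.norm_of_nonneg (by positivity), abs_of_pos ht0, Real.rpow_sub ht0, Real.rpow_two]
    gcongr
    linarith
  have hIoi : IntegrableOn (fun t : ℝ => |t| ^ q / (t ^ 2 + 1)) (Ioi 0) := by
    rw [← Ioc_union_Ioi_eq_Ioi (zero_le_one' ℝ)]
    exact hIoc.union hIoi1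
  have hIio : IntegrableOn (fun t : ℝ => |t| ^ q / (t ^ 2 + 1)) (Iio 0) := by
    have h : IntegrableOn (fun t : ℝ => |t| ^ q / (t ^ 2 + 1)) (Ioi (-0)) := by simpa using hIoi
    simpa using h.comp_neg_Iio
  have hIic := (integrableOn_Iic_iff_integrableOn_Iio (b := (0 : ℝ))).2 hIio
  rw [← integrableOn_univ, ← Iic_union_Ioi (a := (0 : ℝ))]
  exact hIic.union hIoi

theorem abs_rpow_div_comp_mul {q h : ℝ} (hh : 0 < h) (u : ℝ) :
    |h * u| ^ q / ((h * u) ^ 2 + h ^ 2) = h ^ (q - 2) * (|u| ^ q / (u ^ 2 + 1)) := by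
  rw [abs_mul, abs_of_pos hh, Real.mul_rpow hh.le (abs_nonneg u), Real.rpow_sub hh, Real.rpow_two]
  field_simp

theorem integrable_abs_rpow_div {q h : ℝ} (hq : -1 < q) (hq1 : q < 1) (hh : 0 < h) :
    Integrable fun t : ℝ => |t| ^ q / (t ^ 2 + h ^ 2) := by
  rw [← integrable_comp_mul_left_iff (fun t : ℝ => |t| ^ q / (t ^ 2 + h ^ 2)) hh.ne']
  simp_rw [abs_rpow_div_comp_mul hh]
  exact (integrable_abs_rpow_div_sq_add_one hq hq1).const_mul _

/-- Scaling `t = h u`. It is applied with `q = γ - 1` and prefactor `h ^ 2`, and with `q = γ` and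
prefactor `h`; both give `h ^ γ`. -/
theorem integral_abs_rpow_div {q h : ℝ} (hh : 0 < h) :
    ∫ t : ℝ, |t| ^ q / (t ^ 2 + h ^ 2) = h ^ (q - 1) * ∫ t : ℝ, |t| ^ q / (t ^ 2 + 1) := by
  have h1 := Measure.integral_comp_mul_left (fun t : ℝ => |t| ^ q / (t ^ 2 + h ^ 2)) h
  simp_rw [abs_rpow_div_comp_mul hh, integral_const_mul, smul_eq_mul, abs_inv, abs_of_pos hh] at h1
  rw [eq_inv_mul_iff_mul_eq₀ hh.ne'] at h1
  rw [← h1, ← mul_assoc]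
  congr 1
  nth_rw 1 [← Real.rpow_one h]
  rw [← Real.rpow_add hh]
  ring_nf

/-- The kernel `cot (t / 2)`. -/
noncomputable def halfCot (t : ℝ) : ℝ := Real.cos (t / 2) / Real.sin (t / 2)

/-- The regularised kernel `sin (t / 2) cos (t / 2) / (sin (t / 2) ^ 2 + h ^ 2)`. -/
noncomputable def smoothCot (h t : ℝ) : ℝ :=
  Real.sin (t / 2) * Real.cos (t / 2) / (Real.sin (t / 2) ^ 2 + h ^ 2)

theorem halfCot_neg (t : ℝ) : halfCot (-t) = -halfCot t := by
  simp [halfCot, neg_div, div_neg]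

theorem halfCot_periodic : Function.Periodic halfCot (2 * Real.pi) := fun t => by
  have h : (t + 2 * Real.pi) / 2 = t / 2 + Real.pi := by ring
  simp [halfCot, h, neg_div_neg_eq]

theorem measurable_halfCot : Measurable halfCot := by
  unfold halfCot; fun_prop

theorem smoothCot_neg (h t : ℝ) : smoothCot h (-t) = -smoothCot h t := by
  simp [smoothCot, neg_div]

theorem smoothCot_periodic (h : ℝ) : Function.Periodic (smoothCot h) (2 * Real.pi) := fun t => by
  have h : (t + 2 * Real.pi) / 2 = t / 2 + Real.pi := by ring
  simp [smoothCot, h]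

theorem continuous_smoothCot {h : ℝ} (hh : 0 < h) : Continuous (smoothCot h) := by
  unfold smoothCot
  exact Continuous.div (by fun_prop) (by fun_prop) fun t => by positivity

/-- Jordan's inequality `|sin x| ≥ 2 |x| / π` at `x = t / 2`. -/
theorem abs_div_pi_le_abs_sin_half {t : ℝ} (ht : |t| ≤ Real.pi) :
    |t| / Real.pi ≤ |Real.sin (t / 2)| := by
  have h := Real.mul_abs_le_abs_sin (x := t / 2) (by rw [abs_div, abs_two]; linarith)
  rw [abs_div, abs_two] at h
  convert h using 1
  ring

theorem abs_halfCot_le {t : ℝ} (ht : |t| ≤ Real.pi) : |halfCot t| ≤ Real.pi / |t| := by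
  rcases eq_or_ne t 0 with rfl | h0
  · simp [halfCot]
  have h1 := abs_div_pi_le_abs_sin_half ht
  have h2 : 0 < |t| := abs_pos.2 h0
  rw [halfCot, abs_div]
  calc |Real.cos (t / 2)| / |Real.sin (t / 2)| ≤ 1 / (|t| / Real.pi) :=
        div_le_div₀ zero_le_one (Real.abs_cos_le_one _) (div_pos h2 Real.pi_pos) h1
    _ = Real.pi / |t| := by rw [one_div_div]

theorem inv_sin_sq_add_le {t h : ℝ} (ht : |t| ≤ Real.pi) (hh : 0 < h) :
    1 / (Real.sin (t / 2) ^ 2 + h ^ 2) ≤ Real.pi ^ 2 / (t ^ 2 + h ^ 2) := by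
  have h1 := pow_le_pow_left₀ (by positivity) (abs_div_pi_le_abs_sin_half ht) 2
  rw [sq_abs, div_pow, sq_abs, div_le_iff₀ (by positivity)] at h1
  rw [div_le_div_iff₀ (by positivity) (by positivity)]
  have h2 : 1 ≤ Real.pi ^ 2 := by nlinarith [Real.pi_gt_three]
  nlinarith [sq_nonneg h]

/-- The difference is exactly `-h ^ 2 cot (t / 2) / (sin (t / 2) ^ 2 + h ^ 2)`: of size `1 / |t|`
near the pole, but `O(h ^ 2)` away from it. -/
theorem abs_smoothCot_sub_halfCot_le {t h : ℝ} (ht : |t| ≤ Real.pi) (hh : 0 < h) :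
    |smoothCot h t - halfCot t| ≤ Real.pi ^ 3 * h ^ 2 * (|t|⁻¹ / (t ^ 2 + h ^ 2)) := by
  -- At `t = 0` both sides vanish, since division by zero gives zero.
  rcases eq_or_ne t 0 with rfl | h0
  · simp [halfCot, smoothCot]
  have h1 := abs_div_pi_le_abs_sin_half ht
  have h2 : 0 < |t| := abs_pos.2 h0
  have hs : Real.sin (t / 2) ≠ 0 := abs_pos.1 (lt_of_lt_of_le (div_pos h2 Real.pi_pos) h1)
  have hA : 0 < Real.sin (t / 2) ^ 2 + h ^ 2 := by positivity
  have h3 : smoothCot h t - halfCot t =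
      -(h ^ 2 * halfCot t * (1 / (Real.sin (t / 2) ^ 2 + h ^ 2))) := by
    unfold smoothCot halfCot
    field_simp
    ring
  rw [h3, abs_neg, abs_mul, abs_mul, abs_of_pos (by positivity : 0 < h ^ 2),
    abs_of_pos (by positivity : 0 < 1 / (Real.sin (t / 2) ^ 2 + h ^ 2))]
  calc _ ≤ h ^ 2 * (Real.pi / |t|) * (Real.pi ^ 2 / (t ^ 2 + h ^ 2)) := by
        refine mul_le_mul (mul_le_mul_of_nonneg_left (abs_halfCot_le ht) (by positivity))
          (inv_sin_sq_add_le ht hh) (by positivity) (by positivity)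
    _ = _ := by
        field_simp

/-- A mean value estimate for nearby arguments. The factor `sin (b / 2) ^ 2 + h ^ 2` cancels, so
only `a` has to lie in `[-π, π]`; `b` will be a translate that may leave the interval. -/
theorem abs_smoothCot_sub_smoothCot_le {a b h : ℝ} (ha : |a| ≤ Real.pi) (hh : 0 < h)
    (hab : |a - b| ≤ h) :
    |smoothCot h a - smoothCot h b| ≤ Real.pi ^ 2 * h * (1 / (a ^ 2 + h ^ 2)) := by
  set s := Real.sin (a / 2) with hs
  set c := Real.cos (a / 2) with hc
  set s' := Real.sin (b / 2) with hs'
  set c' := Real.cos (b / 2) with hc'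
  have hA : 0 < s ^ 2 + h ^ 2 := by positivity
  have hB : 0 < s' ^ 2 + h ^ 2 := by positivity
  have e1 : |s' * c - c' * s| ≤ h / 2 := by
    have : s' * c - c' * s = Real.sin ((b - a) / 2) := by
      rw [sub_div, Real.sin_sub]
    rw [this]
    calc _ ≤ |(b - a) / 2| := Real.abs_sin_le_abs
      _ = |a - b| / 2 := by rw [abs_div, abs_two, abs_sub_comm]
      _ ≤ h / 2 := by linarith
  have e2 : |s * c - s' * c'| ≤ h / 2 := by
    have : s * c - s' * c' = (Real.sin a - Real.sin b) / 2 := by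
      have h1 := Real.sin_two_mul (a / 2)
      have h2 := Real.sin_two_mul (b / 2)
      rw [mul_div_cancel₀ _ two_ne_zero] at h1 h2
      rw [h1, h2]; ring
    rw [this, abs_div, abs_two]
    have := Real.abs_sin_sub_sin_le a b
    linarith
  have e3 : |s| ≤ |s'| + h / 2 := by
    have h1 := Real.abs_sin_sub_sin_le (a / 2) (b / 2)
    rw [← sub_div, abs_div, abs_two] at h1
    have h2 := abs_sub_abs_le_abs_sub s s'
    linarith
  have e4 : |s * c * (s' ^ 2 + h ^ 2) - s' * c' * (s ^ 2 + h ^ 2)| ≤ h * (s' ^ 2 + h ^ 2) := by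
    -- Each term of this splitting contains a difference of order `h`: `sin ((b - a) / 2)` in the
    -- first, `(sin a - sin b) / 2` in the second.
    have : s * c * (s' ^ 2 + h ^ 2) - s' * c' * (s ^ 2 + h ^ 2) =
      s * s' * (s' * c - c' * s) + h ^ 2 * (s * c - s' * c') := by ring
    rw [this]
    calc _ ≤ |s| * |s'| * |s' * c - c' * s| + h ^ 2 * |s * c - s' * c'| := by
          refine (abs_add_le _ _).trans_eq ?_
          rw [abs_mul, abs_mul, abs_mul, abs_of_pos (by positivity : 0 < h ^ 2)]
      _ ≤ (|s'| + h / 2) * |s'| * (h / 2) + h ^ 2 * (h / 2) := by gcongr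
      _ ≤ _ := by
        rw [← sq_abs s']
        have : 0 ≤ h * (|s'| - h) ^ 2 := by positivity
        have : 0 ≤ h * |s'| ^ 2 := by positivity
        have : 0 ≤ h ^ 3 := by positivity
        nlinarith
  have e5 : smoothCot h a - smoothCot h b =
      (s * c * (s' ^ 2 + h ^ 2) - s' * c' * (s ^ 2 + h ^ 2)) /
        ((s ^ 2 + h ^ 2) * (s' ^ 2 + h ^ 2)) := by
    unfold smoothCot
    rw [div_sub_div _ _ hA.ne' hB.ne']
    ring
  rw [e5, abs_div, abs_of_pos (mul_pos hA hB)]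
  calc _ ≤ h * (s' ^ 2 + h ^ 2) / ((s ^ 2 + h ^ 2) * (s' ^ 2 + h ^ 2)) := by gcongr
    _ = h * (1 / (s ^ 2 + h ^ 2)) := by field_simp
    _ ≤ h * (Real.pi ^ 2 / (a ^ 2 + h ^ 2)) :=
      mul_le_mul_of_nonneg_left (inv_sin_sq_add_le ha hh) hh.le
    _ = _ := by ring

/-! ### Hölder continuity of the Hilbert transform -/

section Privalov

variable {𝕜 : Type*} [RCLike 𝕜] {φ : ℝ → 𝕜} {C γ : ℝ}

/-- The absolutely convergent integral `∫_{-π}^{π} cot (t / 2) (φ (α - t) - φ α) dt`. -/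
noncomputable def hilbertIntegral (φ : ℝ → 𝕜) (α : ℝ) : 𝕜 :=
  ∫ t in -Real.pi..Real.pi, halfCot t • (φ (α - t) - φ α)

/-- The constant `∫ |t| ^ q / (t ^ 2 + 1) dt`. -/
noncomputable def rpowConst (q : ℝ) : ℝ := ∫ t : ℝ, |t| ^ q / (t ^ 2 + 1)

theorem rpowConst_nonneg (q : ℝ) : 0 ≤ rpowConst q :=
  integral_nonneg fun t => by positivity

theorem norm_intervalIntegral_le_rpowConst {f : ℝ → 𝕜} {q h M : ℝ} (hq : -1 < q) (hq1 : q < 1)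
    (hh : 0 < h) (hM : 0 ≤ M)
    (hf : ∀ t, |t| ≤ Real.pi → ‖f t‖ ≤ M * (|t| ^ q / (t ^ 2 + h ^ 2))) :
    ‖∫ t in -Real.pi..Real.pi, f t‖ ≤ M * (h ^ (q - 1) * rpowConst q) := by
  have hle : -Real.pi ≤ Real.pi := by linarith [Real.pi_pos]
  have hint := (integrable_abs_rpow_div hq hq1 hh).const_mul M
  calc _ ≤ ∫ t in -Real.pi..Real.pi, M * (|t| ^ q / (t ^ 2 + h ^ 2)) := by
        refine intervalIntegral.norm_integral_le_of_norm_le hle ?_ hint.intervalIntegrable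
        exact Eventually.of_forall fun t ht => hf t (abs_le.2 ⟨ht.1.le, ht.2⟩)
    _ ≤ ∫ t, M * (|t| ^ q / (t ^ 2 + h ^ 2)) := by
        rw [intervalIntegral.integral_of_le hle]
        exact setIntegral_le_integral hint (Eventually.of_forall fun t => by
          show 0 ≤ M * (|t| ^ q / (t ^ 2 + h ^ 2)); positivity)
    _ = _ := by rw [integral_const_mul, integral_abs_rpow_div hh, rpowConst]

theorem intervalIntegral_eq_zero_of_odd {E : Type*} [NormedAddCommGroup E] [NormedSpace ℝ E]
    {f : ℝ → E} (hf : ∀ t, f (-t) = -f t) (a : ℝ) : ∫ t in -a..a, f t = 0 := by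
  have h := intervalIntegral.integral_comp_neg (a := -a) (b := a) f
  simp_rw [hf, neg_neg, intervalIntegral.integral_neg] at h
  have h2 : (2 : ℝ) • ∫ t in -a..a, f t = 0 := by
    rw [two_smul]; nth_rw 1 [← h]; simp
  exact (smul_eq_zero.1 h2).resolve_left two_ne_zero

theorem intervalIntegral_comp_add_of_periodic {E : Type*} [NormedAddCommGroup E]
    [NormedSpace ℝ E] {f : ℝ → E} (hf : Function.Periodic f (2 * Real.pi)) (c : ℝ) :
    ∫ t in -Real.pi..Real.pi, f (t + c) = ∫ t in -Real.pi..Real.pi, f t := by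
  rw [intervalIntegral.integral_comp_add_right]
  have h := hf.intervalIntegral_add_eq (-Real.pi + c) (-Real.pi)
  convert h using 2 <;> ring

/-- Subtracting `φ α` weakens the `1 / t` singularity to `|t| ^ (γ - 1)`, which is integrable for `γ
> 0`. This is why `hilbertIntegral` needs no principal value. -/
theorem norm_halfCot_smul_le (hφ : ∀ x y, ‖φ x - φ y‖ ≤ C * |x - y| ^ γ) (α : ℝ)
    {t : ℝ} (ht : |t| ≤ Real.pi) (ht0 : t ≠ 0) :
    ‖halfCot t • (φ (α - t) - φ α)‖ ≤ C * Real.pi * |t| ^ (γ - 1) := by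
  have h1 := hφ (α - t) α
  rw [sub_sub_cancel_left, abs_neg] at h1
  have h0 := abs_pos.2 ht0
  rw [norm_smul, Real.norm_eq_abs, Real.rpow_sub_one h0.ne']
  calc _ ≤ Real.pi / |t| * (C * |t| ^ γ) :=
        mul_le_mul (abs_halfCot_le ht) h1 (norm_nonneg _) (by positivity)
    _ = _ := by ring

theorem intervalIntegrable_abs_rpow {q : ℝ} (hq : -1 < q) (hq1 : q < 1) :
    IntervalIntegrable (fun t : ℝ => |t| ^ q) volume (-Real.pi) Real.pi := by
  have h := (integrable_abs_rpow_div hq hq1 one_pos).intervalIntegrable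
    (a := -Real.pi) (b := Real.pi)
  have h2 := h.mul_continuousOn (g := fun t : ℝ => t ^ 2 + 1 ^ 2) (by fun_prop)
  refine h2.congr fun t _ => ?_
  have : t ^ 2 + (1 : ℝ) ^ 2 ≠ 0 := by positivity
  field_simp

theorem intervalIntegrable_halfCot_smul (hγ : 0 < γ) (hγ1 : γ < 1)
    (hc : Continuous φ) (hφ : ∀ x y, ‖φ x - φ y‖ ≤ C * |x - y| ^ γ) (α : ℝ) :
    IntervalIntegrable (fun t => halfCot t • (φ (α - t) - φ α)) volume
      (-Real.pi) Real.pi := by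
  refine ((intervalIntegrable_abs_rpow (q := γ - 1) (by linarith) (by linarith)).const_mul
    (C * Real.pi)).mono_fun' ?_ ?_
  · exact (measurable_halfCot.aestronglyMeasurable.smul
      (by fun_prop : Continuous fun t => φ (α - t) - φ α).aestronglyMeasurable)
  · have hne : ∀ᵐ t : ℝ ∂volume.restrict (uIoc (-Real.pi) Real.pi), t ≠ 0 :=
      ae_restrict_of_ae (Measure.ae_ne volume 0)
    filter_upwards [ae_restrict_mem measurableSet_uIoc, hne] with t ht ht0
    rw [uIoc_of_le (by linarith [Real.pi_pos])] at ht
    exact norm_halfCot_smul_le hφ α (abs_le.2 ⟨ht.1.le, ht.2⟩) ht0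

/-- The regularised kernel is odd, so `φ α` may be subtracted there too. The kernel error then meets
`|φ (α - t) - φ α| ≤ C |t| ^ γ`, leaving the exponent `q = γ - 1`. -/
theorem norm_hilbertIntegral_sub_smooth_le (hγ : 0 < γ) (hγ1 : γ < 1) (hC : 0 ≤ C)
    (hc : Continuous φ) (hφ : ∀ x y, ‖φ x - φ y‖ ≤ C * |x - y| ^ γ) (α : ℝ) {h : ℝ} (hh : 0 < h) :
    ‖(∫ t in -Real.pi..Real.pi, smoothCot h t • φ (α - t)) - hilbertIntegral φ α‖ ≤
      C * Real.pi ^ 3 * rpowConst (γ - 1) * h ^ γ := by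
  have hk := continuous_smoothCot hh
  have h0 : ∫ t in -Real.pi..Real.pi, smoothCot h t • φ α = 0 :=
    intervalIntegral_eq_zero_of_odd (fun t => by rw [smoothCot_neg, neg_smul]) _
  have e : (∫ t in -Real.pi..Real.pi, smoothCot h t • φ (α - t)) - hilbertIntegral φ α =
      ∫ t in -Real.pi..Real.pi, (smoothCot h t - halfCot t) • (φ (α - t) - φ α) := by
    rw [hilbertIntegral, ← sub_zero (∫ t in -Real.pi..Real.pi, smoothCot h t • φ (α - t)), ← h0,
      ← intervalIntegral.integral_sub, ← intervalIntegral.integral_sub]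
    · simp_rw [sub_smul, smul_sub]
    · exact Continuous.intervalIntegrable (by fun_prop) _ _
    · exact intervalIntegrable_halfCot_smul hγ hγ1 hc hφ α
    · exact Continuous.intervalIntegrable (by fun_prop) _ _
    · exact Continuous.intervalIntegrable (by fun_prop) _ _
  rw [e]
  refine (norm_intervalIntegral_le_rpowConst (q := γ - 1) (h := h)
    (M := C * Real.pi ^ 3 * h ^ 2) (by linarith) (by linarith) hh (by positivity)
    fun t ht => ?_).trans_eq ?_
  · rcases eq_or_ne t 0 with rfl | ht0
    · simp only [sub_zero, sub_self, smul_zero, norm_zero]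
      positivity
    have h1 := hφ (α - t) α
    rw [sub_sub_cancel_left, abs_neg] at h1
    rw [norm_smul, Real.norm_eq_abs, Real.rpow_sub_one (abs_pos.2 ht0).ne']
    calc _ ≤ Real.pi ^ 3 * h ^ 2 * (|t|⁻¹ / (t ^ 2 + h ^ 2)) * (C * |t| ^ γ) :=
          mul_le_mul (abs_smoothCot_sub_halfCot_le ht hh) h1 (norm_nonneg _) (by positivity)
      _ = _ := by ring
  · have : h ^ γ = h ^ 2 * h ^ (γ - 1 - 1) := by
      rw [← Real.rpow_two, ← Real.rpow_add hh]; ring_nf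
    rw [this]; ring

/-- By periodicity the translation from `α` to `β` moves from `φ` to the smooth kernel. Both kernels
have mean zero over a period, so the same constant `φ α` can be subtracted in both integrals. -/
theorem norm_smooth_sub_smooth_le (hγ : 0 < γ) (hγ1 : γ < 1) (hC : 0 ≤ C)
    (hp : Function.Periodic φ (2 * Real.pi))
    (hc : Continuous φ) (hφ : ∀ x y, ‖φ x - φ y‖ ≤ C * |x - y| ^ γ) {α β h : ℝ} (hh : 0 < h)
    (hαβ : |α - β| ≤ h) :
    ‖(∫ t in -Real.pi..Real.pi, smoothCot h t • φ (α - t)) -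
      ∫ t in -Real.pi..Real.pi, smoothCot h t • φ (β - t)‖ ≤
      C * Real.pi ^ 2 * rpowConst γ * h ^ γ := by
  have hk := continuous_smoothCot hh
  have hodd : ∫ t in -Real.pi..Real.pi, smoothCot h t • φ α = 0 :=
    intervalIntegral_eq_zero_of_odd (fun t => by rw [smoothCot_neg, neg_smul]) _
  have hshift : ∫ t in -Real.pi..Real.pi, smoothCot h (t + (β - α)) • φ α = 0 := by
    rw [← hodd]
    exact intervalIntegral_comp_add_of_periodic (f := fun t => smoothCot h t • φ α)
      (fun t => by simp only [smoothCot_periodic h t]) _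
  have hβ : ∫ t in -Real.pi..Real.pi, smoothCot h t • φ (β - t) =
      ∫ t in -Real.pi..Real.pi, smoothCot h (t + (β - α)) • φ (α - t) := by
    rw [← intervalIntegral_comp_add_of_periodic (f := fun t => smoothCot h t • φ (β - t))
      (fun t => by
        simp only [smoothCot_periodic h t, ← sub_sub, hp.sub_eq]) (β - α)]
    congr! 4 with t
    ring
  have e : (∫ t in -Real.pi..Real.pi, smoothCot h t • φ (α - t)) -
      ∫ t in -Real.pi..Real.pi, smoothCot h t • φ (β - t) =
      ∫ t in -Real.pi..Real.pi,
        (smoothCot h t - smoothCot h (t + (β - α))) • (φ (α - t) - φ α) := by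
    rw [hβ, ← sub_zero (∫ t in -Real.pi..Real.pi, smoothCot h t • φ (α - t)), ← hodd,
      ← sub_zero (∫ t in -Real.pi..Real.pi, smoothCot h (t + (β - α)) • φ (α - t)), ← hshift,
      ← intervalIntegral.integral_sub, ← intervalIntegral.integral_sub,
      ← intervalIntegral.integral_sub]
    · simp_rw [sub_smul, smul_sub]
    all_goals exact Continuous.intervalIntegrable (by fun_prop) _ _
  rw [e]
  refine (norm_intervalIntegral_le_rpowConst (q := γ) (h := h)
    (M := C * Real.pi ^ 2 * h) (by linarith) (by linarith) hh (by positivity)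
    fun t ht => ?_).trans_eq ?_
  · have h1 := hφ (α - t) α
    rw [sub_sub_cancel_left, abs_neg] at h1
    rw [norm_smul, Real.norm_eq_abs]
    have h2 : |t - (t + (β - α))| ≤ h := by
      rwa [show t - (t + (β - α)) = α - β by ring]
    calc _ ≤ Real.pi ^ 2 * h * (1 / (t ^ 2 + h ^ 2)) * (C * |t| ^ γ) :=
          mul_le_mul (abs_smoothCot_sub_smoothCot_le ht hh h2) h1 (norm_nonneg _) (by positivity)
      _ = _ := by ring
  · have : h ^ γ = h * h ^ (γ - 1) := by
      nth_rw 2 [← Real.rpow_one h]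
      rw [← Real.rpow_add hh]; ring_nf
    rw [this]; ring

/-- The Hölder constant of the Hilbert transform, up to a normalisation. -/
noncomputable def privalovConst (γ : ℝ) : ℝ :=
  2 * Real.pi ^ 3 * rpowConst (γ - 1) + Real.pi ^ 2 * rpowConst γ

theorem privalovConst_nonneg (γ : ℝ) : 0 ≤ privalovConst γ := by
  have := rpowConst_nonneg (γ - 1)
  have := rpowConst_nonneg γ
  unfold privalovConst
  positivity

/-- Privalov's theorem for periodic Hölder functions. -/
theorem norm_hilbertIntegral_sub_le (hγ : 0 < γ) (hγ1 : γ < 1) (hC : 0 ≤ C)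
    (hp : Function.Periodic φ (2 * Real.pi))
    (hc : Continuous φ) (hφ : ∀ x y, ‖φ x - φ y‖ ≤ C * |x - y| ^ γ) (α β : ℝ) :
    ‖hilbertIntegral φ α - hilbertIntegral φ β‖ ≤ C * privalovConst γ * |α - β| ^ γ := by
  rcases eq_or_ne α β with rfl | hne
  · simp [Real.zero_rpow hγ.ne']
  -- The regularisation scale is `h = |α - β|`. Two replacements of the kernel and one translation
  -- each cost `O(h ^ γ)`.
  have hh : 0 < |α - β| := abs_pos.2 (sub_ne_zero.2 hne)
  have h1 := norm_hilbertIntegral_sub_smooth_le hγ hγ1 hC hc hφ α hh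
  have h2 := norm_hilbertIntegral_sub_smooth_le hγ hγ1 hC hc hφ β hh
  have h3 := norm_smooth_sub_smooth_le hγ hγ1 hC hp hc hφ hh le_rfl
  set A := ∫ t in -Real.pi..Real.pi, smoothCot |α - β| t • φ (α - t)
  set B := ∫ t in -Real.pi..Real.pi, smoothCot |α - β| t • φ (β - t)
  have e : hilbertIntegral φ α - hilbertIntegral φ β =
      (A - B) - (A - hilbertIntegral φ α) + (B - hilbertIntegral φ β) := by ring
  rw [e]
  refine (norm_add_le_of_le (norm_sub_le_of_le h3 h1) h2).trans_eq ?_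
  unfold privalovConst
  ring

theorem hilbertIntegral_periodic (hp : Function.Periodic φ (2 * Real.pi)) :
    Function.Periodic (hilbertIntegral φ) (2 * Real.pi) := fun α => by
  unfold hilbertIntegral
  congr! 4 with t
  · rw [add_sub_right_comm, hp]
  · exact hp α

end Privalov

/-! ### Principal values -/

/-- The points at distance at least `ε` from the zeros of `t ↦ sin (t - α)`. -/
def sinAway (α ε : ℝ) : Set ℝ := {t | ∀ s : ℝ, Real.sin (s - α) = 0 → ε ≤ |t - s|}

theorem truncatedInterval_eq (α ε : ℝ) :
    truncatedInterval α ε = Icc (-Real.pi) Real.pi ∩ sinAway α ε := rfl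

theorem isClosed_sinAway (α ε : ℝ) : IsClosed (sinAway α ε) := by
  simp only [sinAway, ofPred_forall]
  exact isClosed_iInter fun s => isClosed_iInter fun _ =>
    isClosed_le continuous_const (by fun_prop)

theorem isCompact_truncatedInterval (α ε : ℝ) : IsCompact (truncatedInterval α ε) :=
  isCompact_Icc.inter_right (isClosed_sinAway α ε)

theorem add_mem_sinAway {α ε t : ℝ} (c : ℝ) : t + c ∈ sinAway (α + c) ε ↔ t ∈ sinAway α ε := by
  refine ⟨fun h s hs => ?_, fun h s hs => ?_⟩
  · simpa using h (s + c) (by simpa using hs)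
  · have := h (s - c) (by rwa [sub_sub, add_comm c α])
    rwa [show t + c - s = t - (s - c) by ring]

/-- The zeros of `sin (t - α)` are invariant under translation by `π`. Hence one truncation serves
both Hilbert kernels, with poles at `α` and at `α + π`. -/
theorem sinAway_add_pi (α ε : ℝ) : sinAway (α + Real.pi) ε = sinAway α ε := by
  simp [sinAway, ← sub_sub]

theorem add_pi_mem_sinAway {α ε t : ℝ} : t + Real.pi ∈ sinAway α ε ↔ t ∈ sinAway α ε := by
  nth_rw 1 [← sinAway_add_pi]
  exact add_mem_sinAway _

theorem add_two_pi_mem_sinAway {α ε t : ℝ} :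
    t + 2 * Real.pi ∈ sinAway α ε ↔ t ∈ sinAway α ε := by
  rw [two_mul, ← add_assoc, add_pi_mem_sinAway, add_pi_mem_sinAway]

theorem neg_mem_sinAway {ε t : ℝ} : -t ∈ sinAway 0 ε ↔ t ∈ sinAway 0 ε := by
  have key : ∀ u : ℝ, u ∈ sinAway 0 ε → -u ∈ sinAway 0 ε := fun u h s hs => by
    have := h (-s) (by simpa using hs)
    rwa [show -u - s = -(u - -s) by ring, abs_neg]
  exact ⟨fun h => by simpa using key _ h, key t⟩

theorem sin_ne_zero_of_mem_sinAway {α ε t : ℝ} (hε : 0 < ε) (ht : t ∈ sinAway α ε) :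
    Real.sin (t - α) ≠ 0 := fun h => by
  have := ht t h
  rw [sub_self, abs_zero] at this
  linarith

/-- The sine is 1-Lipschitz, so `|sin t|` is at most the distance from `t` to any zero. Thus every
`t` with `sin t ≠ 0` survives the truncation for small `ε`. -/
theorem mem_sinAway_of_le_abs_sin {ε t : ℝ} (h : ε ≤ |Real.sin t|) : t ∈ sinAway 0 ε := by
  intro s hs
  rw [sub_zero] at hs
  have := Real.abs_sin_sub_sin_le t s
  rw [hs, sub_zero] at this
  exact h.trans this

section PV

variable {𝕜 : Type*} [RCLike 𝕜] {φ : ℝ → 𝕜} {C γ : ℝ}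

theorem setIntegral_truncatedInterval (f : ℝ → 𝕜) (α ε : ℝ) :
    ∫ t in truncatedInterval α ε, f t =
      ∫ t in -Real.pi..Real.pi, (sinAway α ε).indicator f t := by
  rw [intervalIntegral.integral_of_le (by linarith [Real.pi_pos]),
    ← integral_Icc_eq_integral_Ioc, setIntegral_indicator (isClosed_sinAway α ε).measurableSet,
    truncatedInterval_eq]

theorem intervalIntegrable_indicator {f : ℝ → 𝕜} {α ε : ℝ}
    (hf : ContinuousOn f (truncatedInterval α ε)) :
    IntervalIntegrable ((sinAway α ε).indicator f) volume (-Real.pi) Real.pi := by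
  rw [intervalIntegrable_iff_integrableOn_Icc_of_le (by linarith [Real.pi_pos]),
    integrableOn_indicator_iff (isClosed_sinAway α ε).measurableSet, inter_comm,
    ← truncatedInterval_eq]
  exact hf.integrableOn_compact (isCompact_truncatedInterval α ε)

theorem div_ofReal_eq_smul (x : 𝕜) (r : ℝ) : x / ((r : ℝ) : 𝕜) = r⁻¹ • x := by
  rw [RCLike.real_smul_eq_coe_mul, RCLike.ofReal_inv, div_eq_inv_mul]

theorem sin_half_ne_zero {t : ℝ} (ht : Real.sin t ≠ 0) : Real.sin (t / 2) ≠ 0 := fun h => ht <| by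
  rw [← mul_div_cancel₀ t (two_ne_zero' ℝ), Real.sin_two_mul, h]; ring

theorem cos_half_ne_zero {t : ℝ} (ht : Real.sin t ≠ 0) : Real.cos (t / 2) ≠ 0 := fun h => ht <| by
  rw [← mul_div_cancel₀ t (two_ne_zero' ℝ), Real.sin_two_mul, h]; ring

theorem continuousOn_halfCot_smul {f : ℝ → 𝕜} (hf : Continuous f) {ε : ℝ} (hε : 0 < ε) :
    ContinuousOn (fun t => halfCot t • f t) (truncatedInterval 0 ε) := by
  refine ContinuousOn.smul ?_ hf.continuousOn
  unfold halfCot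
  refine ContinuousOn.div (by fun_prop) (by fun_prop) fun t ht => sin_half_ne_zero ?_
  simpa using sin_ne_zero_of_mem_sinAway hε ht.2

/-- The truncated set is symmetric, so the odd kernel annihilates the constant `φ α`; dominated
convergence handles the rest. Neighbourhoods of `±π` are removed too, harmlessly, since `cot (t /
2)` has no pole there. -/
theorem tendsto_integral_indicator_halfCot (hγ : 0 < γ) (hγ1 : γ < 1)
    (hc : Continuous φ) (hφ : ∀ x y, ‖φ x - φ y‖ ≤ C * |x - y| ^ γ) (α : ℝ) :
    Tendsto (fun ε : ℝ => ∫ t in -Real.pi..Real.pi,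
      (sinAway 0 ε).indicator (fun t => halfCot t • φ (α - t)) t) (𝓝[>] 0)
      (𝓝 (hilbertIntegral φ α)) := by
  have e : ∀ ε : ℝ, 0 < ε → ∫ t in -Real.pi..Real.pi,
      (sinAway 0 ε).indicator (fun t => halfCot t • (φ (α - t) - φ α)) t =
      ∫ t in -Real.pi..Real.pi, (sinAway 0 ε).indicator (fun t => halfCot t • φ (α - t)) t := by
    intro ε hε
    have h0 : ∫ t in -Real.pi..Real.pi,
        (sinAway 0 ε).indicator (fun t => halfCot t • φ α) t = 0 := by
      refine intervalIntegral_eq_zero_of_odd (fun t => ?_) _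
      by_cases ht : t ∈ sinAway 0 ε
      · rw [indicator_of_mem (neg_mem_sinAway.2 ht), indicator_of_mem ht, halfCot_neg, neg_smul]
      · rw [indicator_of_notMem (mt neg_mem_sinAway.1 ht), indicator_of_notMem ht, neg_zero]
    rw [← sub_zero (∫ t in -Real.pi..Real.pi,
      (sinAway 0 ε).indicator (fun t => halfCot t • φ (α - t)) t), ← h0,
      ← intervalIntegral.integral_sub
        (intervalIntegrable_indicator (continuousOn_halfCot_smul (by fun_prop) hε))
        (intervalIntegrable_indicator (continuousOn_halfCot_smul (by fun_prop) hε))]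
    congr! 2 with t
    by_cases ht : t ∈ sinAway 0 ε
    · simp only [indicator_of_mem ht, smul_sub]
    · simp only [indicator_of_notMem ht, sub_zero]
  have hint := intervalIntegrable_halfCot_smul hγ hγ1 hc hφ α
  refine Tendsto.congr' (eventually_mem_nhdsWithin.mono fun ε hε => e ε hε) ?_
  refine intervalIntegral.tendsto_integral_filter_of_dominated_convergence
    (fun t => ‖halfCot t • (φ (α - t) - φ α)‖) ?_ ?_ hint.norm ?_
  · refine Eventually.of_forall fun ε => ?_
    exact ((measurable_halfCot.aestronglyMeasurable.smul
      (by fun_prop : Continuous fun t => φ (α - t) - φ α).aestronglyMeasurable)).indicator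
      (isClosed_sinAway 0 ε).measurableSet
  · exact Eventually.of_forall fun ε => Eventually.of_forall fun t _ =>
      norm_indicator_le_norm_self _ _
  -- In `(-π, π]` the sine vanishes only at `0` and `π`, a null set.
  · filter_upwards [Measure.ae_ne volume 0, Measure.ae_ne volume Real.pi] with t h0 hπ ht
    rw [uIoc_of_le (by linarith [Real.pi_pos])] at ht
    have hs : Real.sin t ≠ 0 := by
      rcases lt_or_gt_of_ne h0 with h | h
      · exact (Real.sin_neg_of_neg_of_neg_pi_lt h ht.1).ne
      · exact (Real.sin_pos_of_pos_of_lt_pi h (lt_of_le_of_ne ht.2 hπ)).ne'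
    refine tendsto_const_nhds.congr' ?_
    filter_upwards [Ioo_mem_nhdsGT (abs_pos.2 hs)] with ε hε
    rw [indicator_of_mem (mem_sinAway_of_le_abs_sin hε.2.le)]

theorem integral_indicator_halfCot_add (φ : ℝ → 𝕜) (α ε : ℝ) :
    ∫ t in -Real.pi..Real.pi, (sinAway 0 ε).indicator (fun t => halfCot t • φ (t + α)) t =
      -∫ t in -Real.pi..Real.pi, (sinAway 0 ε).indicator (fun t => halfCot t • φ (α - t)) t := by
  have h := intervalIntegral.integral_comp_neg (a := -Real.pi) (b := Real.pi)
    ((sinAway 0 ε).indicator (fun t => halfCot t • φ (t + α)))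
  rw [neg_neg] at h
  rw [← intervalIntegral.integral_neg, ← h]
  congr! 2 with t
  by_cases ht : t ∈ sinAway 0 ε
  · rw [indicator_of_mem (neg_mem_sinAway.2 ht), indicator_of_mem ht, halfCot_neg, neg_smul,
      neg_add_eq_sub]
  · rw [indicator_of_notMem (mt neg_mem_sinAway.1 ht), indicator_of_notMem ht, neg_zero]

theorem hasPV_tan (hγ : 0 < γ) (hγ1 : γ < 1)
    (hc : Continuous φ) (hφ : ∀ x y, ‖φ x - φ y‖ ≤ C * |x - y| ^ γ) (α : ℝ) :
    HasPV 0 (fun t : ℝ => φ (α - t) / ((Real.tan (t / 2) : ℝ) : 𝕜)) (hilbertIntegral φ α) := by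
  have e : (fun t : ℝ => φ (α - t) / ((Real.tan (t / 2) : ℝ) : 𝕜)) =
      fun t => halfCot t • φ (α - t) := by
    funext t
    rw [div_ofReal_eq_smul, Real.tan_eq_sin_div_cos, inv_div, halfCot]
  rw [e]
  refine ⟨fun ε hε => (continuousOn_halfCot_smul (by fun_prop) hε).integrableOn_compact
    (isCompact_truncatedInterval 0 ε), ?_⟩
  simp_rw [setIntegral_truncatedInterval]
  exact tendsto_integral_indicator_halfCot hγ hγ1 hc hφ α

/-- Since `cot ((t + π) / 2) = -tan (t / 2)`, this is the half-angle identity `2 / sin t = cot (t /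
2) + tan (t / 2)`. -/
theorem inv_sin_eq_halfCot {t : ℝ} (ht : Real.sin t ≠ 0) :
    (Real.sin t)⁻¹ = (halfCot t - halfCot (t + Real.pi)) / 2 := by
  have h1 := sin_half_ne_zero ht
  have h2 := cos_half_ne_zero ht
  have h3 : Real.sin t = 2 * Real.sin (t / 2) * Real.cos (t / 2) := by
    rw [← Real.sin_two_mul, mul_div_cancel₀ t (two_ne_zero' ℝ)]
  rw [h3, halfCot, halfCot, add_div, Real.cos_add_pi_div_two, Real.sin_add_pi_div_two]
  field_simp
  linarith [Real.sin_sq_add_cos_sq (t / 2)]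

/-- The kernel identity holds exactly at each truncation level, before any limit. The translates by
`α` and `π` are absorbed by periodicity, and the reflection `t ↦ -t` reverses the sign of both
terms. -/
theorem integral_indicator_inv_sin (hc : Continuous φ) (hp : Function.Periodic φ (2 * Real.pi))
    (α : ℝ) {ε : ℝ} (hε : 0 < ε) :
    ∫ t in -Real.pi..Real.pi,
        (sinAway α ε).indicator (fun θ => (Real.sin (θ - α))⁻¹ • φ θ) t =
      (2⁻¹ : ℝ) • ((∫ t in -Real.pi..Real.pi,
          (sinAway 0 ε).indicator (fun t => halfCot t • φ (α + Real.pi - t)) t) -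
        ∫ t in -Real.pi..Real.pi,
          (sinAway 0 ε).indicator (fun t => halfCot t • φ (α - t)) t) := by
  have hper : Function.Periodic
      ((sinAway α ε).indicator (fun θ => (Real.sin (θ - α))⁻¹ • φ θ)) (2 * Real.pi) := fun t => by
    by_cases ht : t ∈ sinAway α ε
    · rw [indicator_of_mem (add_two_pi_mem_sinAway.2 ht), indicator_of_mem ht, hp,
        add_sub_right_comm, Real.sin_add_two_pi]
    · rw [indicator_of_notMem (mt add_two_pi_mem_sinAway.1 ht), indicator_of_notMem ht]
  have hper2 : Function.Periodic
      ((sinAway 0 ε).indicator (fun t => halfCot t • φ (t + (α + Real.pi)))) (2 * Real.pi) :=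
    fun t => by
      by_cases ht : t ∈ sinAway 0 ε
      · rw [indicator_of_mem (add_two_pi_mem_sinAway.2 ht), indicator_of_mem ht,
          halfCot_periodic, add_right_comm, hp]
      · rw [indicator_of_notMem (mt add_two_pi_mem_sinAway.1 ht), indicator_of_notMem ht]
  have e1 : ∀ t, (sinAway α ε).indicator (fun θ => (Real.sin (θ - α))⁻¹ • φ θ) (t + α) =
      (2⁻¹ : ℝ) • ((sinAway 0 ε).indicator (fun t => halfCot t • φ (t + α)) t -
        (sinAway 0 ε).indicator (fun t => halfCot t • φ (t + (α + Real.pi))) (t + Real.pi)) := by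
    intro t
    have hiff : t + α ∈ sinAway α ε ↔ t ∈ sinAway 0 ε := by
      simpa using add_mem_sinAway (α := 0) (ε := ε) (t := t) α
    by_cases ht : t ∈ sinAway 0 ε
    · rw [indicator_of_mem (hiff.2 ht), indicator_of_mem ht,
        indicator_of_mem (add_pi_mem_sinAway.2 ht), add_sub_cancel_right, inv_sin_eq_halfCot
        (by simpa using sin_ne_zero_of_mem_sinAway hε ht),
        show t + Real.pi + (α + Real.pi) = t + α + 2 * Real.pi by ring, hp, ← sub_smul,
        smul_smul, div_eq_inv_mul]
    · rw [indicator_of_notMem (mt hiff.1 ht), indicator_of_notMem ht,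
        indicator_of_notMem (mt add_pi_mem_sinAway.1 ht), sub_zero, smul_zero]
  have hi : ∀ β : ℝ, IntervalIntegrable
      ((sinAway 0 ε).indicator (fun t => halfCot t • φ (t + β))) volume (-Real.pi) Real.pi :=
    fun β => intervalIntegrable_indicator (continuousOn_halfCot_smul (by fun_prop) hε)
  -- The shift by `π` leaves `[-π, π]`; integrability there follows from integrability over one
  -- period.
  have hi2 : IntervalIntegrable (fun t =>
      (sinAway 0 ε).indicator (fun t => halfCot t • φ (t + (α + Real.pi))) (t + Real.pi))
      volume (-Real.pi) Real.pi := by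
    refine (IntervalIntegrable.comp_add_right_iff (by simp)).2 ?_
    exact hper2.intervalIntegrable (t := -Real.pi) Real.two_pi_pos.ne'
      (by convert hi (α + Real.pi) using 1; ring) _ _
  rw [← intervalIntegral_comp_add_of_periodic hper α]
  simp_rw [e1]
  rw [intervalIntegral.integral_smul, intervalIntegral.integral_sub (hi α) hi2,
    intervalIntegral_comp_add_of_periodic hper2, integral_indicator_halfCot_add,
    integral_indicator_halfCot_add, neg_sub_neg]

theorem hasPV_sin (hγ : 0 < γ) (hγ1 : γ < 1) (hp : Function.Periodic φ (2 * Real.pi))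
    (hc : Continuous φ) (hφ : ∀ x y, ‖φ x - φ y‖ ≤ C * |x - y| ^ γ) (α : ℝ) :
    HasPV α (fun θ : ℝ => φ θ / ((Real.sin (θ - α) : ℝ) : 𝕜))
      ((2⁻¹ : ℝ) • (hilbertIntegral φ (α + Real.pi) - hilbertIntegral φ α)) := by
  simp_rw [div_ofReal_eq_smul]
  refine ⟨fun ε hε => ContinuousOn.integrableOn_compact (isCompact_truncatedInterval α ε) ?_, ?_⟩
  · refine ContinuousOn.smul (ContinuousOn.inv₀ (by fun_prop) fun t ht => ?_) hc.continuousOn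
    exact sin_ne_zero_of_mem_sinAway hε ht.2
  · simp_rw [setIntegral_truncatedInterval]
    refine Tendsto.congr' (eventually_mem_nhdsWithin.mono fun ε hε =>
      (integral_indicator_inv_sin hc hp α hε).symm) ?_
    exact ((tendsto_integral_indicator_halfCot hγ hγ1 hc hφ _).sub
      (tendsto_integral_indicator_halfCot hγ hγ1 hc hφ α)).const_smul _

end PV

/-! ### The Hilbert transform as an operator on `Λ_γ` -/

namespace HolderSpace

variable {𝕜 : Type*} [RCLike 𝕜] {γ : ℝ≥0}

theorem norm_apply_sub_le (φ : HolderSpace 𝕜 γ) (x y : ℝ) :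
    ‖φ x - φ y‖ ≤ ‖φ‖ * |x - y| ^ (γ : ℝ) := by
  have h := φ.2.2.holderWith.nndist_le x y
  have h' : ((nndist (φ x) (φ y) : ℝ≥0) : ℝ) ≤
    ((nnHolderNorm γ (φ : ℝ → 𝕜) * nndist x y ^ (γ : ℝ) : ℝ≥0) : ℝ) := by exact_mod_cast h
  rw [coe_nndist, NNReal.coe_mul, NNReal.coe_rpow, coe_nndist, dist_eq_norm, Real.dist_eq] at h'
  exact h'

theorem holderWith_of_norm_sub_le {f : ℝ → 𝕜} {C : ℝ} (hC : 0 ≤ C)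
    (h : ∀ x y, ‖f x - f y‖ ≤ C * |x - y| ^ (γ : ℝ)) : HolderWith C.toNNReal γ f := fun x y => by
  rw [edist_nndist, edist_nndist, ← ENNReal.coe_rpow_of_nonneg _ γ.coe_nonneg, ← ENNReal.coe_mul,
    ENNReal.coe_le_coe, ← NNReal.coe_le_coe, NNReal.coe_mul, NNReal.coe_rpow, coe_nndist,
    coe_nndist, dist_eq_norm, Real.dist_eq, Real.coe_toNNReal _ hC]
  exact h x y

theorem norm_le_of_norm_sub_le (φ : HolderSpace 𝕜 γ) {C : ℝ} (hC : 0 ≤ C)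
    (h : ∀ x y, ‖φ x - φ y‖ ≤ C * |x - y| ^ (γ : ℝ)) : ‖φ‖ ≤ C :=
  by
  have h' := NNReal.coe_le_coe.2 (holderWith_of_norm_sub_le hC h).nnholderNorm_le
  rwa [Real.coe_toNNReal _ hC] at h'

theorem continuous_coe (hγ : 0 < γ) (φ : HolderSpace 𝕜 γ) : Continuous (φ : ℝ → 𝕜) :=
  φ.2.2.holderWith.continuous hγ

theorem periodic_coe (φ : HolderSpace 𝕜 γ) : Function.Periodic (φ : ℝ → 𝕜) (2 * Real.pi) := φ.2.1

theorem sum_smul_apply {ι : Type*} (s : Finset ι) (c : ι → 𝕜) (ψ : ι → HolderSpace 𝕜 γ) (x : ℝ) :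
    (∑ i ∈ s, c i • ψ i : HolderSpace 𝕜 γ) x = ∑ i ∈ s, c i * ψ i x := by
  let e : HolderSpace 𝕜 γ →ₗ[𝕜] 𝕜 :=
    { toFun := fun φ => φ x, map_add' := fun _ _ => rfl, map_smul' := fun _ _ => rfl }
  exact map_sum e (fun i => c i • ψ i) s

theorem norm_sub_le_tsum {ι : Type*} {c : ι → 𝕜} {ψ : ι → HolderSpace 𝕜 γ} {f : ℝ → 𝕜}
    (hs : Summable fun i => ‖c i‖ * ‖ψ i‖) (hf : ∀ x, HasSum (fun i => c i * ψ i x) (f x))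
    (x y : ℝ) : ‖f x - f y‖ ≤ (∑' i, ‖c i‖ * ‖ψ i‖) * |x - y| ^ (γ : ℝ) := by
  rw [← ((hf x).sub (hf y)).tsum_eq]
  refine tsum_of_norm_bounded (hs.hasSum.mul_right _) fun i => ?_
  rw [← mul_sub, norm_mul, mul_assoc]
  gcongr
  exact norm_apply_sub_le _ _ _

/-- A pointwise sum with summable seminorms is a sum in the seminormed space `Λ_γ`. -/
theorem exists_hasSum_of_pointwise {ι : Type*} {c : ι → 𝕜} {ψ : ι → HolderSpace 𝕜 γ} {f : ℝ → 𝕜}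
    (hs : Summable fun i => ‖c i‖ * ‖ψ i‖) (hf : ∀ x, HasSum (fun i => c i * ψ i x) (f x)) :
    ∃ Ψ : HolderSpace 𝕜 γ, (Ψ : ℝ → 𝕜) = f ∧ HasSum (fun i => c i • ψ i) Ψ := by
  have hper : Function.Periodic f (2 * Real.pi) := fun x => by
    have h := hf (x + 2 * Real.pi)
    simp_rw [fun i => periodic_coe (ψ i) x] at h
    exact h.unique (hf x)
  let Ψ : HolderSpace 𝕜 γ := ⟨f, hper, (holderWith_of_norm_sub_le
    (tsum_nonneg fun i => by positivity) (norm_sub_le_tsum hs hf)).memHolder⟩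
  refine ⟨Ψ, rfl, ?_⟩
  -- The pointwise sum supplies the candidate limit; its distance to a partial sum is at most the
  -- tail of `∑ ‖c i‖ ‖ψ i‖`.
  have hlim := tendsto_tsum_compl_atTop_zero (fun i => ‖c i‖ * ‖ψ i‖)
  refine tendsto_iff_norm_sub_tendsto_zero.2
    (squeeze_zero (fun _ => norm_nonneg _) (fun s => ?_) hlim)
  rw [norm_sub_rev]
  refine norm_le_of_norm_sub_le _ (tsum_nonneg fun i => by positivity) ?_
  refine norm_sub_le_tsum (c := fun i : {i // i ∉ s} => c i) (hs.subtype _) fun x => ?_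
  have h1 : (Ψ - ∑ i ∈ s, c i • ψ i : HolderSpace 𝕜 γ) x = f x - ∑ i ∈ s, c i * ψ i x := by
    rw [← sum_smul_apply]; rfl
  rw [h1]
  refine (Finset.hasSum_compl_iff (f := fun i => c i * ψ i x) s).2 ?_
  rw [sub_add_cancel]
  exact hf x

theorem hilbertIntegral_add (hγ0 : 0 < γ) (hγ1 : γ < 1) (φ ψ : HolderSpace 𝕜 γ) (α : ℝ) :
    hilbertIntegral (φ + ψ : HolderSpace 𝕜 γ) α = hilbertIntegral φ α + hilbertIntegral ψ α := by
  unfold hilbertIntegral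
  rw [← intervalIntegral.integral_add]
  · congr! 2 with t
    rw [← smul_add]
    congr 1
    exact add_sub_add_comm (φ (α - t)) (ψ (α - t)) (φ α) (ψ α)
  · exact intervalIntegrable_halfCot_smul (NNReal.coe_pos.2 hγ0) (NNReal.coe_lt_one.2 hγ1)
      (continuous_coe hγ0 φ) (norm_apply_sub_le φ) α
  · exact intervalIntegrable_halfCot_smul (NNReal.coe_pos.2 hγ0) (NNReal.coe_lt_one.2 hγ1)
      (continuous_coe hγ0 ψ) (norm_apply_sub_le ψ) α

theorem hilbertIntegral_smul (c : 𝕜) (φ : HolderSpace 𝕜 γ) (α : ℝ) :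
    hilbertIntegral (c • φ : HolderSpace 𝕜 γ) α = c * hilbertIntegral φ α := by
  unfold hilbertIntegral
  rw [← intervalIntegral.integral_const_mul]
  congr! 2 with t
  rw [mul_smul_comm]
  congr 1
  exact (mul_sub c (φ (α - t)) (φ α)).symm

theorem norm_hilbertIntegral_sub_le' (hγ0 : 0 < γ) (hγ1 : γ < 1) (φ : HolderSpace 𝕜 γ) (x y : ℝ) :
    ‖(2 * Real.pi)⁻¹ • hilbertIntegral φ x - (2 * Real.pi)⁻¹ • hilbertIntegral φ y‖ ≤
      (2 * Real.pi)⁻¹ * privalovConst γ * ‖φ‖ * |x - y| ^ (γ : ℝ) := by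
  have h0 : 0 ≤ (2 * Real.pi)⁻¹ := by positivity
  rw [← smul_sub, norm_smul, Real.norm_of_nonneg h0, mul_assoc, mul_assoc]
  refine mul_le_mul_of_nonneg_left ?_ h0
  refine (norm_hilbertIntegral_sub_le (NNReal.coe_pos.2 hγ0) (NNReal.coe_lt_one.2 hγ1)
    (norm_nonneg φ) (periodic_coe φ)
    (continuous_coe hγ0 φ) (norm_apply_sub_le φ) x y).trans_eq ?_
  ring

/-- The periodic Hilbert transform as a bounded operator on `Λ_γ`. -/
noncomputable def hilbertTransform (𝕜 : Type*) [RCLike 𝕜] (hγ0 : 0 < γ) (hγ1 : γ < 1) :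
    HolderSpace 𝕜 γ →L[𝕜] HolderSpace 𝕜 γ :=
  have hC (φ : HolderSpace 𝕜 γ) : 0 ≤ (2 * Real.pi)⁻¹ * privalovConst γ * ‖φ‖ := by
    have := privalovConst_nonneg γ
    positivity
  LinearMap.mkContinuous
    { toFun := fun φ => ⟨fun α => (2 * Real.pi)⁻¹ • hilbertIntegral φ α,
        fun α => by simp only [hilbertIntegral_periodic (periodic_coe φ) α],
        (holderWith_of_norm_sub_le (hC φ) (norm_hilbertIntegral_sub_le' hγ0 hγ1 φ)).memHolder⟩
      map_add' := fun φ ψ => Subtype.ext <| funext fun α => by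
        refine (congrArg _ (hilbertIntegral_add hγ0 hγ1 φ ψ α)).trans ?_
        exact smul_add (2 * Real.pi)⁻¹ (hilbertIntegral φ α) (hilbertIntegral ψ α)
      map_smul' := fun c φ => Subtype.ext <| funext fun α => by
        refine (congrArg _ (hilbertIntegral_smul c φ α)).trans ?_
        exact mul_smul_comm (2 * Real.pi)⁻¹ c (hilbertIntegral φ α) |>.symm }
    ((2 * Real.pi)⁻¹ * privalovConst γ) fun φ =>
      norm_le_of_norm_sub_le _ (hC φ) (norm_hilbertIntegral_sub_le' hγ0 hγ1 φ)

theorem hilbertTransform_apply (hγ0 : 0 < γ) (hγ1 : γ < 1) (φ : HolderSpace 𝕜 γ) (α : ℝ) :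
    hilbertTransform 𝕜 hγ0 hγ1 φ α = (2 * Real.pi)⁻¹ • hilbertIntegral φ α := rfl

theorem isHilbertValue_hilbertTransform (hγ0 : 0 < γ) (hγ1 : γ < 1) (φ : HolderSpace 𝕜 γ)
    (α : ℝ) : IsHilbertValue φ α (hilbertTransform 𝕜 hγ0 hγ1 φ α) := by
  refine ⟨_, hasPV_tan (NNReal.coe_pos.2 hγ0) (NNReal.coe_lt_one.2 hγ1)
    (continuous_coe hγ0 φ) (norm_apply_sub_le φ) α, ?_⟩
  rw [hilbertTransform_apply, RCLike.real_smul_eq_coe_mul, one_div]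

/-- The functional `φ ↦ φ x - φ y` on `Λ_γ`. -/
noncomputable def evalSub (𝕜 : Type*) [RCLike 𝕜] (γ : ℝ≥0) (x y : ℝ) : HolderSpace 𝕜 γ →L[𝕜] 𝕜 :=
  LinearMap.mkContinuous
    { toFun := fun φ => φ x - φ y
      map_add' := fun φ ψ => add_sub_add_comm (φ x) (ψ x) (φ y) (ψ y)
      map_smul' := fun c φ => (mul_sub c (φ x) (φ y)).symm }
    (|x - y| ^ (γ : ℝ)) fun φ => (norm_apply_sub_le φ x y).trans_eq (mul_comm _ _)

theorem evalSub_apply (x y : ℝ) (φ : HolderSpace 𝕜 γ) : evalSub 𝕜 γ x y φ = φ x - φ y := rfl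

theorem norm_evalSub_le (x y : ℝ) : ‖evalSub 𝕜 γ x y‖ ≤ |x - y| ^ (γ : ℝ) :=
  LinearMap.mkContinuous_norm_le _ (by positivity) _

/-- The principal value of `φ (θ) / sin (θ - α)` in terms of the Hilbert transform. -/
theorem hasPV_sin_hilbertTransform (hγ0 : 0 < γ) (hγ1 : γ < 1) (φ : HolderSpace 𝕜 γ) (α : ℝ) :
    HasPV α (fun θ : ℝ => φ θ / ((Real.sin (θ - α) : ℝ) : 𝕜))
      (Real.pi • evalSub 𝕜 γ (α + Real.pi) α (hilbertTransform 𝕜 hγ0 hγ1 φ)) := by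
  convert hasPV_sin (NNReal.coe_pos.2 hγ0) (NNReal.coe_lt_one.2 hγ1)
    (periodic_coe φ) (continuous_coe hγ0 φ) (norm_apply_sub_le φ) α using 1
  rw [evalSub_apply, hilbertTransform_apply, hilbertTransform_apply, ← smul_sub, smul_smul]
  congr 1
  have := Real.pi_pos.ne'
  field_simp

end HolderSpace

/-! ### Functionals on the projective tensor product -/

namespace AlgTensor

variable {𝕜 E F : Type*} [RCLike 𝕜] [SeminormedAddCommGroup E] [NormedSpace 𝕜 E]
  [SeminormedAddCommGroup F] [NormedSpace 𝕜 F]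

/-- The functional `x ⊗ y ↦ A x * B y` on the algebraic tensor product. -/
noncomputable def mulFunctional (A : E →L[𝕜] 𝕜) (B : F →L[𝕜] 𝕜) : AlgTensor 𝕜 E F →ₗ[𝕜] 𝕜 :=
  (TensorProduct.lift ((LinearMap.mul 𝕜 𝕜).compl₁₂ (A : E →ₗ[𝕜] 𝕜) (B : F →ₗ[𝕜] 𝕜)) :
    E ⊗[𝕜] F →ₗ[𝕜] 𝕜)

theorem mulFunctional_tmul (A : E →L[𝕜] 𝕜) (B : F →L[𝕜] 𝕜) (x : E) (y : F) :
    mulFunctional A B (tmul 𝕜 x y) = A x * B y :=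
  TensorProduct.lift.tmul (f' := (LinearMap.mul 𝕜 𝕜).compl₁₂ (A : E →ₗ[𝕜] 𝕜) (B : F →ₗ[𝕜] 𝕜)) x y

theorem norm_eq_sInf (t : AlgTensor 𝕜 E F) : ‖t‖ = sInf (reprCosts t) := rfl

/-- The bound holds against the cost of every finite representation of `t`, hence against their
infimum. -/
theorem norm_mulFunctional_le (A : E →L[𝕜] 𝕜) (B : F →L[𝕜] 𝕜) (t : AlgTensor 𝕜 E F) :
    ‖mulFunctional A B t‖ ≤ ‖A‖ * ‖B‖ * ‖t‖ := by
  rw [norm_eq_sInf, ← smul_eq_mul (‖A‖ * ‖B‖), ← Real.sInf_smul_of_nonneg (by positivity)]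
  refine le_csInf (reprCosts_nonempty t).smul_set ?_
  rintro _ ⟨_, ⟨n, x, y, rfl, rfl⟩, rfl⟩
  rw [map_sum]
  simp only [mulFunctional_tmul, smul_eq_mul, Finset.mul_sum]
  refine norm_sum_le_of_le _ fun i _ => ?_
  rw [norm_mul]
  calc _ ≤ (‖A‖ * ‖x i‖) * (‖B‖ * ‖y i‖) :=
        mul_le_mul (A.le_opNorm _) (B.le_opNorm _) (norm_nonneg _) (by positivity)
    _ = _ := by ring

theorem exists_projTensor_functional (A : E →L[𝕜] 𝕜) (B : F →L[𝕜] 𝕜) :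
    ∃ L : ProjTensor 𝕜 E F →L[𝕜] 𝕜,
      (∀ x y, L ((tmul 𝕜 x y : AlgTensor 𝕜 E F) : ProjTensor 𝕜 E F) = A x * B y) ∧
      ‖L‖ ≤ ‖A‖ * ‖B‖ := by
  let l : AlgTensor 𝕜 E F →L[𝕜] 𝕜 :=
    (mulFunctional A B).mkContinuous (‖A‖ * ‖B‖) (norm_mulFunctional_le A B)
  refine ⟨l.fromCompletion, fun x y => ?_, ?_⟩
  · rw [ContinuousLinearMap.fromCompletion_apply_coe]
    exact mulFunctional_tmul A B x y
  · refine ContinuousLinearMap.opNorm_le_bound _ (by positivity) fun u => ?_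
    refine UniformSpace.Completion.induction_on u
      (isClosed_le (by fun_prop) (by fun_prop)) fun t => ?_
    rw [ContinuousLinearMap.fromCompletion_apply_coe, UniformSpace.Completion.norm_coe]
    exact norm_mulFunctional_le A B t

end AlgTensor

/-! ### The operator `𝒦₂` -/

section K2

variable {𝕜 : Type*} [RCLike 𝕜] {γ : ℝ≥0}

theorem norm_integralCLM'_le_one {α : Type*} [MeasurableSpace α] {μ : Measure α} :
    ‖(L1.integralCLM' 𝕜 : (α →₁[μ] 𝕜) →L[𝕜] 𝕜)‖ ≤ 1 :=
  ContinuousLinearMap.opNorm_le_bound _ zero_le_one fun f => by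
    rw [← L1.integral_eq' 𝕜 f, one_mul]
    exact L1.norm_integral_le f

/-- Summable `L¹` norms force absolute convergence almost everywhere; the weights `b n` are absorbed
into the functions. -/
theorem ae_summable_norm_mul_of_summable_Lp_norm {α E : Type*} [MeasurableSpace α] {μ : Measure α}
    [NormedAddCommGroup E] [NormedSpace ℝ E] {f : ℕ → Lp E 1 μ} {b : ℕ → ℝ} (hb : ∀ n, 0 ≤ b n)
    (hs : Summable fun n => ‖f n‖ * b n) :
    ∀ᵐ x ∂μ, Summable fun n => ‖f n x‖ * b n := by
  have h := summable_norm_of_tsum_eLpNorm_ne_top (μ := μ) le_rfl (f := fun n => b n • ⇑(f n))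
    (fun n => (Lp.aestronglyMeasurable (f n)).const_smul (b n)) (by
      simp_rw [eLpNorm_const_smul, ← Lp.enorm_def]
      have : Summable fun n => ‖b n • f n‖ := by
        simpa only [norm_smul, Real.norm_of_nonneg (hb _), mul_comm] using hs
      simpa only [enorm_smul] using (tsum_enorm_ne_top_iff_summable_norm.2 this))
  filter_upwards [h] with x hx
  simpa only [Pi.smul_apply, norm_smul, Real.norm_of_nonneg (hb _), mul_comm] using hx

/-- A function representing an element of the tensor product has a value under `𝒦₂`, given by the
Hilbert transform. -/
theorem isK2Value_of_represents (hγ0 : 0 < γ) (hγ1 : γ < 1) {α : ℝ}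
    {L : ProjTensor 𝕜 (L1Pos 𝕜) (evenHolder 𝕜 γ) →L[𝕜] 𝕜}
    (hL : ∀ (f : L1Pos 𝕜) (ψ : evenHolder 𝕜 γ),
      L ((AlgTensor.tmul 𝕜 f ψ : AlgTensor 𝕜 (L1Pos 𝕜) (evenHolder 𝕜 γ)) :
        ProjTensor 𝕜 (L1Pos 𝕜) (evenHolder 𝕜 γ)) = L1.integralCLM' 𝕜 f *
          HolderSpace.evalSub 𝕜 γ (α + Real.pi) α
            (HolderSpace.hilbertTransform 𝕜 hγ0 hγ1 (ψ : HolderSpace 𝕜 γ)))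
    {u : ProjTensor 𝕜 (L1Pos 𝕜) (evenHolder 𝕜 γ)} {φ : ℝ → ℝ → 𝕜} (hφ : Represents φ u) :
    IsK2Value φ α (L u) := by
  obtain ⟨f, ψ, hs, hu, hae⟩ := hφ
  set B : HolderSpace 𝕜 γ →L[𝕜] 𝕜 := (HolderSpace.evalSub 𝕜 γ (α + Real.pi) α).comp
    (HolderSpace.hilbertTransform 𝕜 hγ0 hγ1) with hB
  have hsum : Summable fun n => ‖B (ψ n) • f n‖ := by
    refine Summable.of_nonneg_of_le (fun n => norm_nonneg _) (fun n => ?_) (hs.mul_left ‖B‖)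
    rw [norm_smul, mul_comm ‖f n‖, ← mul_assoc]
    exact mul_le_mul_of_nonneg_right (B.le_opNorm _) (norm_nonneg _)
  -- `G` is the inner integral up to the factor `π`: `G ρ` will be `B` applied to `φ(ρ, ·)`, while
  -- `∫ G` is `L u`.
  set G : L1Pos 𝕜 := ∑' n, B (ψ n) • f n with hG
  have hGsum : HasSum (fun n => B (ψ n) • f n) G := hsum.of_norm.hasSum
  have hLu : L u = L1.integralCLM' 𝕜 G := by
    refine (hu.mapL L).unique ?_
    refine (hGsum.mapL (L1.integralCLM' 𝕜)).congr_fun fun n => ?_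
    rw [hL, map_smul, smul_eq_mul, mul_comm]
    rfl
  have hGint : L1.integralCLM' 𝕜 G = ∫ ρ in Ioi (0 : ℝ), G ρ := by
    rw [← L1.integral_eq', L1.integral_eq_integral]
  refine ⟨fun ρ => Real.pi • G ρ, ?_, (L1.integrable_coeFn G).smul Real.pi, ?_⟩
  · have h1 := Lp.hasSum_coeFn_tsum (tsum_enorm_ne_top_iff_summable_norm.2 hsum)
    have h2 : ∀ᵐ ρ ∂(volume.restrict (Ioi (0 : ℝ))), ∀ n,
        (B (ψ n) • f n : L1Pos 𝕜) ρ = B (ψ n) * f n ρ :=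
      ae_all_iff.2 fun n => Lp.coeFn_smul (B (ψ n)) (f n)
    filter_upwards [h1, h2, hae,
      ae_summable_norm_mul_of_summable_Lp_norm (fun n => norm_nonneg (ψ n)) hs]
      with ρ h1 h2 h3 h4
    -- Seminorm convergence lets `B` pass through the sum. Limits in `Λ_γ` are unique only up to
    -- constants, so the two limits are compared in `𝕜`, after applying `B`.
    obtain ⟨Ψ, hΨ, hΨsum⟩ := HolderSpace.exists_hasSum_of_pointwise
      (ψ := fun n => (ψ n : HolderSpace 𝕜 γ)) h4 h3
    have hval : G ρ = B Ψ := by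
      refine h1.unique ((hΨsum.mapL B).congr_fun fun n => ?_)
      rw [h2, map_smul, smul_eq_mul, mul_comm]
    rw [hval, ← hΨ]
    exact HolderSpace.hasPV_sin_hilbertTransform hγ0 hγ1 Ψ α
  · rw [hLu, hGint, integral_smul, RCLike.real_smul_eq_coe_mul, ← mul_assoc, ← RCLike.ofReal_mul,
      one_div_mul_cancel Real.pi_pos.ne', RCLike.ofReal_one, one_mul]

end K2

theorem mainTheorem3 (𝕜 : Type*) [RCLike 𝕜] (γ : ℝ≥0) (hγ0 : 0 < γ) (hγ1 : γ < 1) :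
    ∃ H : HolderSpace 𝕜 γ →L[𝕜] HolderSpace 𝕜 γ,
      (∀ (φ : HolderSpace 𝕜 γ) (α : ℝ), IsHilbertValue φ α (H φ α)) ∧
      ∀ α ∈ Icc (-Real.pi) Real.pi,
        ∃ L : ProjTensor 𝕜 (L1Pos 𝕜) (evenHolder 𝕜 γ) →L[𝕜] 𝕜,
          (∀ (u : ProjTensor 𝕜 (L1Pos 𝕜) (evenHolder 𝕜 γ)) (φ : ℝ → ℝ → 𝕜),
            Represents φ u → IsK2Value φ α (L u)) ∧
          ‖L‖ ≤ (γ : ℝ)⁻¹ * Real.pi ^ ((γ : ℝ) - 1) + ‖H‖ * (2 * Real.pi) ^ (γ : ℝ) := by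
  refine ⟨HolderSpace.hilbertTransform 𝕜 hγ0 hγ1,
    HolderSpace.isHilbertValue_hilbertTransform hγ0 hγ1, fun α _ => ?_⟩
  set H := HolderSpace.hilbertTransform 𝕜 hγ0 hγ1
  obtain ⟨L, hL, hLn⟩ := AlgTensor.exists_projTensor_functional
    (L1.integralCLM' 𝕜 : L1Pos 𝕜 →L[𝕜] 𝕜)
    (((HolderSpace.evalSub 𝕜 γ (α + Real.pi) α).comp H).comp (evenHolder 𝕜 γ).subtypeL)
  refine ⟨L, fun u φ hφ => isK2Value_of_represents hγ0 hγ1 hL hφ, ?_⟩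
  have hB : ‖((HolderSpace.evalSub 𝕜 γ (α + Real.pi) α).comp H).comp (evenHolder 𝕜 γ).subtypeL‖ ≤
      Real.pi ^ (γ : ℝ) * ‖H‖ := by
    refine ContinuousLinearMap.opNorm_le_bound _ (by positivity) fun ψ => ?_
    have h1 := HolderSpace.norm_evalSub_le (𝕜 := 𝕜) (γ := γ) (α + Real.pi) α
    rw [add_sub_cancel_left, abs_of_pos Real.pi_pos] at h1
    rw [mul_assoc]
    exact (HolderSpace.evalSub 𝕜 γ (α + Real.pi) α).le_of_opNorm_le_of_le h1
      (H.le_opNorm (ψ : HolderSpace 𝕜 γ))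
  -- The argument yields the bound `π ^ γ ‖H‖`; enlarging it to `(2π) ^ γ ‖H‖` and adding the
  -- nonnegative first term gives `c_γ`.
  have h2 : Real.pi ^ (γ : ℝ) ≤ (2 * Real.pi) ^ (γ : ℝ) := by
    gcongr
    linarith [Real.pi_pos]
  calc ‖L‖ ≤ 1 * (Real.pi ^ (γ : ℝ) * ‖H‖) :=
        hLn.trans (mul_le_mul norm_integralCLM'_le_one hB (norm_nonneg _) zero_le_one)
    _ ≤ ‖H‖ * (2 * Real.pi) ^ (γ : ℝ) := by
        rw [one_mul, mul_comm]
        gcongr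
    _ ≤ _ := le_add_of_nonneg_left (by positivity)
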